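/- Let $a<b$ and let $f^*$ be drawn from a centred Gaussian process on $[a,b]$ such that, for all points $x_1<\dots<x_n$ in $[a,b]$, the conditional mean of $f^*$ given $f^*(x_1),\dots,f^*(x_n)$ is, on $[x_1,x_n]$, the piecewise linear interpolant of the data $(x_i,f^*(x_i))$. Assume that the process is non-trivial, i.e. it is not almost surely affine: for some $x\in[a,b]$, with positive probability, $$f^*(x)\neq\frac{(b-x)f^*(a)+(x-a)f^*(b)}{b-a}.$$ For $n\ge 1$ put $$\mathrm{Trap}(g,\alpha,\beta,n)=\frac{\beta-\alpha}{2n}\Big(g(\alpha)+g(\beta)+2\sum_{i=1}^{n-1}g\big(\alpha+\tfrac{i(\beta-\alpha)}{n}\big)\Big).$$ For $\rho\in\mathbb{R}$, $m\ge 1$ and $k\ge 1$, the recursive procedure $\mathrm{AdapTrap}_{\rho,m,k}(g,\alpha,\beta,\tau)$ computes $Q_1=\mathrm{Trap}(g,\alpha,\beta,m)$ and $Q_2=\mathrm{Trap}(g,\alpha,\beta,2m)$; if $|Q_2-Q_1|<\tau$ it returns $Q_2$; otherwise it returns $$\sum_{i=0}^{k-1}\mathrm{AdapTrap}_{\rho,m,k}\Big(g,\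 \alpha+\tfrac{(\beta-\alpha)i}{k},\ \alpha+\tfrac{(\beta-\alpha)(i+1)}{k},\ \rho\tau\Big).$$ Let $N_{\rho,m,k}(g,\tau)\in\mathbb{N}\cup\{\infty\}$ be the total number of evaluations of $g$ in the run of $\mathrm{AdapTrap}_{\rho,m,k}(g,a,b,\tau)$, with $N_{\rho,m,k}(g,\tau)=\infty$ if the procedure does not terminate. Then for every integer $m\ge1$ and every positive even integer $k$ there exists $C>0$ such that, for every $\tau\le C$ and every $\rho$ with $0\le\rho\le k^{-3/2}$, $$\mathbb{E}^*\big[N_{\rho,m,k}(f^*,\tau)\big]=\infty .$$ This holds both when $N_{\rho,m,k}$ counts every evaluation with repetition and when it counts only the distinct points at which $g$ is evaluated. -/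

import Mathlib

open MeasureTheory ProbabilityTheory
open scoped ENNReal

noncomputable section

/-- The composite trapezoidal rule for `f` on `[a, b]` with `n` subintervals of equal length. -/
def trap (f : ℝ → ℝ) (a b : ℝ) (n : ℕ) : ℝ :=
  (b - a) / (2 * n) * (f a + f b + 2 * ∑ i ∈ Finset.Ico 1 n, f (a + i * (b - a) / n))

/-- The abscissae at which `trap f a b n` evaluates `f`, one entry per evaluation. -/
def trapPoints (a b : ℝ) (n : ℕ) : Multiset ℝ :=
  {a, b} + (Finset.Ico 1 n).val.map (fun i : ℕ => a + i * (b - a) / n)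

/-- `AdapTrapRun ρ m k f a b τ I X`: the procedure `AdapTrap` with parameters `ρ, m, k`, called on
`(f, a, b, τ)`, terminates and returns `I`, and `X` lists (with multiplicity) all abscissae at which
`f` is evaluated during the run, those of the recursive calls included. A call that does not
terminate is related to no pair `(I, X)`. -/
inductive AdapTrapRun (ρ : ℝ) (m k : ℕ) (f : ℝ → ℝ) :
    ℝ → ℝ → ℝ → ℝ → Multiset ℝ → Prop
  | accept (a b τ : ℝ) (h : |trap f a b (2 * m) - trap f a b m| < τ) :
      AdapTrapRun ρ m k f a b τ (trap f a b (2 * m)) (trapPoints a b m + trapPoints a b (2 * m))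
  | split (a b τ : ℝ) (h : ¬ |trap f a b (2 * m) - trap f a b m| < τ)
      (I : Fin k → ℝ) (X : Fin k → Multiset ℝ)
      (hrec : ∀ i : Fin k, AdapTrapRun ρ m k f
        (a + (b - a) * (i : ℕ) / k) (a + (b - a) * ((i : ℕ) + 1) / k) (ρ * τ) (I i) (X i)) :
      AdapTrapRun ρ m k f a b τ (∑ i, I i)
        (trapPoints a b m + trapPoints a b (2 * m) + ∑ i, X i)

/-- The total number of evaluations of `f` in the run of `AdapTrap` on `(f, a, b, τ)`;
it is `⊤` if the procedure does not terminate. -/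
def numEvals (ρ : ℝ) (m k : ℕ) (f : ℝ → ℝ) (a b τ : ℝ) : ℕ∞ :=
  ⨅ (I : ℝ) (X : Multiset ℝ) (_ : AdapTrapRun ρ m k f a b τ I X), (Multiset.card X : ℕ∞)

/-- The number of distinct points at which `f` is evaluated in the run of `AdapTrap` on
`(f, a, b, τ)` (the number of evaluations when all previous values of `f` are stored and reused);
it is `⊤` if the procedure does not terminate. -/
def numDistinctEvals (ρ : ℝ) (m k : ℕ) (f : ℝ → ℝ) (a b τ : ℝ) : ℕ∞ :=
  ⨅ (I : ℝ) (X : Multiset ℝ) (_ : AdapTrapRun ρ m k f a b τ I X), {x | x ∈ X}.encard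

/-- The value at `x` of the affine function through `(x₀, y₀)` and `(x₁, y₁)`. -/
def lineInterp (x₀ x₁ y₀ y₁ x : ℝ) : ℝ :=
  ((x₁ - x) * y₀ + (x - x₀) * y₁) / (x₁ - x₀)

/-- For all data points `x₀ < x₁ < ⋯ < xₙ` in `[a, b]`, the conditional mean of the process `f`
given `f x₀, …, f xₙ` is, over the range of the data points, their piecewise linear interpolant. -/
def HasPiecewiseLinearCondMean {Ω : Type*} [MeasurableSpace Ω] (P : Measure Ω) (a b : ℝ)
    (f : ℝ → Ω → ℝ) : Prop :=
  ∀ (n : ℕ) (x : Fin (n + 1) → ℝ), StrictMono x → (∀ i, x i ∈ Set.Icc a b) →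
    ∀ (i : Fin n), ∀ y ∈ Set.Icc (x i.castSucc) (x i.succ),
      P[f y | MeasurableSpace.comap (fun ω (j : Fin (n + 1)) => f (x j) ω) MeasurableSpace.pi]
        =ᵐ[P] fun ω =>
          lineInterp (x i.castSucc) (x i.succ) (f (x i.castSucc) ω) (f (x i.succ) ω) y

end

/-! The hypothesis forces the process to be an affine function plus a Brownian bridge, as far as
covariances can tell. Testing the conditional mean against the data makes the covariance `K s t`
affine in `s` away from `t`. Hence the residual from the chord over `[a, b]` has covariance `c (s -
a) (b - t)` for `s ≤ t`, with `c > 0` by non-triviality (`exists_bump_diag`).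

The difference `Q₂ - Q₁` on an interval of length `h` is a weighted sum of second differences over
cells. It is therefore independent of the process on the whole lattice of cell endpoints, and is
Gaussian with variance proportional to `h ^ 3`. If the tolerance is at most `C * h ^ (3 / 2)`, the
interval splits with probability at least `3 / 4`, and `ρ ≤ k ^ (-3 / 2)` passes this bound on to
the children.

For even `k`, a child's lattice contains every point its ancestors used, so its own split is
independent of theirs. The calls then grow in mean like a branching process with mean offspring at
least `3 k / 4 > 1` (`le_setLIntegral_numCalls`). Siblings may be dependent, since only expectations
are added. Calls of equal depth use distinct interior points, so the expected number of distinct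
evaluations diverges too. -/

/-! ### Calls and distinct evaluation points. -/

/-- The number of calls at recursion depth `d` made by `AdapTrap` on `(f, a, b, τ)`. -/
noncomputable def numCalls (ρ : ℝ) (m k : ℕ) (f : ℝ → ℝ) : ℕ → ℝ → ℝ → ℝ → ℕ
  | 0, _, _, _ => 1
  | d + 1, a, b, τ =>
    open Classical in
    if |trap f a b (2 * m) - trap f a b m| < τ then 0
    else ∑ i : Fin k, numCalls ρ m k f d
      (a + (b - a) * (i : ℕ) / k) (a + (b - a) * ((i : ℕ) + 1) / k) (ρ * τ)

/-- Neighbouring intervals share endpoints, so distinct calls have to be told apart by interior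
nodes. -/
lemma exists_mem_trapPoints_Ioo {a b : ℝ} (hab : a < b) {n : ℕ} (hn : 2 ≤ n) :
    ∃ x ∈ trapPoints a b n, x ∈ Set.Ioo a b := by
  have hn' : (2 : ℝ) ≤ n := by exact_mod_cast hn
  refine ⟨a + (1 : ℕ) * (b - a) / n, ?_, ?_, ?_⟩
  · refine Multiset.mem_add.2 (Or.inr (Multiset.mem_map.2 ⟨1, ?_, rfl⟩))
    simp only [Finset.mem_val, Finset.mem_Ico]
    omega
  · have : 0 < (b - a) / n := div_pos (by linarith) (by linarith)
    push_cast
    rw [one_mul]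
    linarith
  · have : (b - a) / n < b - a := div_lt_self (by linarith) (by linarith)
    push_cast
    rw [one_mul]
    linarith

lemma subinterval_lt {a b : ℝ} (hab : a < b) {k : ℕ} (hk : 0 < k) (i : ℕ) :
    a + (b - a) * i / k < a + (b - a) * (i + 1) / k := by
  have hk' : (0 : ℝ) < k := by exact_mod_cast hk
  have : (b - a) * i / k < (b - a) * (i + 1) / k :=
    div_lt_div_of_pos_right (mul_lt_mul_of_pos_left (by linarith) (by linarith)) hk'
  linarith

lemma subinterval_subset {a b : ℝ} (hab : a ≤ b) {k : ℕ} (i : Fin k) :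
    a ≤ a + (b - a) * (i : ℕ) / k ∧ a + (b - a) * ((i : ℕ) + 1) / k ≤ b := by
  have hk' : (0 : ℝ) < k := by exact_mod_cast i.pos
  have hi : ((i : ℕ) : ℝ) + 1 ≤ k := by exact_mod_cast i.isLt
  have hba : 0 ≤ b - a := by linarith
  constructor
  · have : 0 ≤ (b - a) * (i : ℕ) / k := by positivity
    linarith
  · have : (b - a) * ((i : ℕ) + 1) / k ≤ b - a := by
      rw [div_le_iff₀ hk']
      exact mul_le_mul_of_nonneg_left hi hba
    linarith

lemma subinterval_ordered {a b : ℝ} (hab : a ≤ b) {k : ℕ} {i j : ℕ} (hij : i < j) :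
    a + (b - a) * ((i : ℕ) + 1) / k ≤ a + (b - a) * (j : ℕ) / k := by
  have hij' : (i : ℝ) + 1 ≤ j := by exact_mod_cast hij
  have := div_le_div_of_nonneg_right
    (mul_le_mul_of_nonneg_left hij' (sub_nonneg.2 hab)) (Nat.cast_nonneg (α := ℝ) k)
  linarith

/-- In a terminating run, distinct calls at the same depth evaluate `f` at distinct interior
points of their intervals. -/
lemma AdapTrapRun.numCalls_le {ρ : ℝ} {m k : ℕ} (hm : 0 < m) (hk : 0 < k) {f : ℝ → ℝ}
    {a b τ I : ℝ} {X : Multiset ℝ} (h : AdapTrapRun ρ m k f a b τ I X) (hab : a < b) (d : ℕ) :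
    open Classical in
    numCalls ρ m k f d a b τ ≤ (X.toFinset.filter (· ∈ Set.Ioo a b)).card := by
  classical
  induction h generalizing d with
  | accept a b τ h =>
    cases d with
    | zero =>
      obtain ⟨x, hx, hx'⟩ := exists_mem_trapPoints_Ioo hab (n := 2 * m) (by omega)
      refine Finset.card_pos.2 ⟨x, Finset.mem_filter.2 ⟨?_, hx'⟩⟩
      simp [hx]
    | succ d => simp [numCalls, h]
  | split a b τ h I X hrec ih =>
    cases d with
    | zero =>
      obtain ⟨x, hx, hx'⟩ := exists_mem_trapPoints_Ioo hab (n := 2 * m) (by omega)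
      refine Finset.card_pos.2 ⟨x, Finset.mem_filter.2 ⟨?_, hx'⟩⟩
      simp [hx]
    | succ d =>
      rw [numCalls, if_neg h]
      refine (Finset.sum_le_sum fun i _ => ih i (subinterval_lt hab hk i) d).trans ?_
      rw [← Finset.card_biUnion]
      · refine Finset.card_le_card fun x hx => ?_
        obtain ⟨i, -, hx⟩ := Finset.mem_biUnion.1 hx
        obtain ⟨hx1, hx2⟩ := Finset.mem_filter.1 hx
        have hs := subinterval_subset hab.le i
        refine Finset.mem_filter.2 ⟨?_, hs.1.trans_lt hx2.1, hx2.2.trans_le hs.2⟩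
        rw [Multiset.mem_toFinset] at hx1 ⊢
        exact Multiset.mem_add.2 (Or.inr (Multiset.mem_sum.2 ⟨i, Finset.mem_univ i, hx1⟩))
      · have key : ∀ i j : Fin k, i < j → Disjoint
            ((X i).toFinset.filter (· ∈ Set.Ioo (a + (b - a) * (i : ℕ) / k)
              (a + (b - a) * ((i : ℕ) + 1) / k)))
            ((X j).toFinset.filter (· ∈ Set.Ioo (a + (b - a) * (j : ℕ) / k)
              (a + (b - a) * ((j : ℕ) + 1) / k))) := by
          intro i j hij
          refine Finset.disjoint_left.2 fun x hx hx' => ?_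
          have h1 := (Finset.mem_filter.1 hx).2.2
          have h2 := (Finset.mem_filter.1 hx').2.1
          have h3 := subinterval_ordered (k := k) hab.le (Fin.lt_def.1 hij)
          linarith
        intro i _ j _ hij
        rcases lt_or_gt_of_ne hij with hij | hij
        · exact key i j hij
        · exact (key j i hij).symm

lemma numCalls_le_numDistinctEvals {ρ : ℝ} {m k : ℕ} (hm : 0 < m) (hk : 0 < k) {f : ℝ → ℝ}
    {a b τ : ℝ} (hab : a < b) (d : ℕ) :
    (numCalls ρ m k f d a b τ : ℕ∞) ≤ numDistinctEvals ρ m k f a b τ := by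
  classical
  -- Without a terminating run the infimum is `⊤`, so only terminating runs need a bound.
  refine le_iInf fun I => le_iInf fun X => le_iInf fun h => ?_
  have h1 := h.numCalls_le hm hk hab d
  have h2 : {x | x ∈ X}.encard = (X.toFinset.card : ℕ∞) := by
    rw [← Set.encard_coe_eq_coe_finsetCard]
    congr 1
    ext x
    simp
  rw [h2]
  refine Nat.cast_le.2 (h1.trans ?_)
  convert Finset.card_filter_le _ _

lemma numDistinctEvals_le_numEvals (ρ : ℝ) (m k : ℕ) (f : ℝ → ℝ) (a b τ : ℝ) :
    numDistinctEvals ρ m k f a b τ ≤ numEvals ρ m k f a b τ := by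
  classical
  refine iInf_mono fun I => iInf_mono fun X => iInf_mono fun h => ?_
  have h2 : {x | x ∈ X}.encard = (X.toFinset.card : ℕ∞) := by
    rw [← Set.encard_coe_eq_coe_finsetCard]
    congr 1
    ext x
    simp
  rw [h2]
  exact Nat.cast_le.2 (Multiset.toFinset_card_le X)

/-! ### The error indicator as a sum of second differences. -/

/-- The second difference of `f` over `[l, r]`. -/
noncomputable def bump (f : ℝ → ℝ) (l r : ℝ) : ℝ := f ((l + r) / 2) - (f l + f r) / 2

lemma trap_eq_sum (f : ℝ → ℝ) (a b : ℝ) {n : ℕ} (hn : 0 < n) :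
    trap f a b n = (b - a) / (2 * n) * ∑ i ∈ Finset.range n,
      (f (a + i * (b - a) / n) + f (a + (i + 1 : ℕ) * (b - a) / n)) := by
  obtain ⟨n, rfl⟩ := Nat.exists_eq_add_of_lt hn
  rw [zero_add]
  have h0 : f b = f (a + (n + 1 : ℕ) * (b - a) / (n + 1 : ℕ)) := by
    congr 1
    field_simp
    ring
  have h1 : f a = f (a + (0 : ℕ) * (b - a) / (n + 1 : ℕ)) := by simp
  rw [trap, Finset.sum_add_distrib,
    Finset.sum_range_succ (fun i => f (a + (i + 1 : ℕ) * (b - a) / (n + 1 : ℕ))),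
    Finset.sum_range_succ', h0, Finset.sum_Ico_eq_sum_range]
  nth_rewrite 1 [h1]
  simp only [Nat.add_sub_cancel, add_comm 1]
  ring

lemma sum_range_two_mul (g : ℕ → ℝ) (m : ℕ) :
    ∑ i ∈ Finset.range (2 * m), g i = ∑ i ∈ Finset.range m, (g (2 * i) + g (2 * i + 1)) := by
  induction m with
  | zero => simp
  | succ m ih => rw [Nat.mul_succ, Finset.sum_range_succ, Finset.sum_range_succ, ih,
      Finset.sum_range_succ, add_assoc]

/-- Halving a cell of width `h` changes its trapezoidal contribution by `h / 2` times its second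
difference. -/
lemma trap_two_mul_sub_trap (f : ℝ → ℝ) (a b : ℝ) {m : ℕ} (hm : 0 < m) :
    trap f a b (2 * m) - trap f a b m = (b - a) / (2 * m) * ∑ i ∈ Finset.range m,
      bump f (a + i * (b - a) / m) (a + (i + 1 : ℕ) * (b - a) / m) := by
  have hm' : (m : ℝ) ≠ 0 := by positivity
  rw [trap_eq_sum f a b hm, trap_eq_sum f a b (show 0 < 2 * m by omega), sum_range_two_mul,
    Finset.mul_sum, Finset.mul_sum, Finset.mul_sum, ← Finset.sum_sub_distrib]
  refine Finset.sum_congr rfl fun i _ => ?_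
  have h0 : a + ((2 * i : ℕ) : ℝ) * (b - a) / ((2 * m : ℕ) : ℝ) = a + i * (b - a) / m := by
    push_cast; field_simp
  have h1 : a + ((2 * i + 1 + 1 : ℕ) : ℝ) * (b - a) / ((2 * m : ℕ) : ℝ)
      = a + (i + 1 : ℕ) * (b - a) / m := by
    push_cast; field_simp; ring
  have h2 : a + ((2 * i + 1 : ℕ) : ℝ) * (b - a) / ((2 * m : ℕ) : ℝ)
      = (a + i * (b - a) / m + (a + (i + 1 : ℕ) * (b - a) / m)) / 2 := by
    push_cast; field_simp; ring
  rw [h0, h1, h2, bump]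
  push_cast
  field_simp
  ring

/-! ### Covariances affine off the diagonal. -/

/-- For each `w`, the function `K · w` is affine on the intervals `[l, r] ⊆ [a, b]` that do not have
`w` in their interior. -/
def IsAffineOffDiagonal (a b : ℝ) (K : ℝ → ℝ → ℝ) : Prop :=
  ∀ l r y w, l < r → a ≤ l → r ≤ b → y ∈ Set.Icc l r → w ∈ Set.Icc a b → w ≤ l ∨ r ≤ w →
    K y w = lineInterp l r (K l w) (K r w) y

namespace IsAffineOffDiagonal

variable {a b : ℝ} {K : ℝ → ℝ → ℝ}

lemma bump_eq_zero (hK : IsAffineOffDiagonal a b K) {l r w : ℝ} (hlr : l < r) (hl : a ≤ l)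
    (hr : r ≤ b) (hw : w ∈ Set.Icc a b) (h : w ≤ l ∨ r ≤ w) : bump (K · w) l r = 0 := by
  have h1 := hK l r ((l + r) / 2) w hlr hl hr ⟨by linarith, by linarith⟩ hw h
  have h2 : r - l ≠ 0 := by linarith
  simp only [bump, h1, lineInterp]
  field_simp
  ring

/-- The bridge covariance is affine in `s` on `[a, t]` and vanishes at `s = a`. -/
lemma bridge_eq (hK : IsAffineOffDiagonal a b K) (hsymm : ∀ s t, K s t = K t s) (hab : a < b)
    {s t : ℝ} (hs : a ≤ s) (hst : s ≤ t) (ht : t ≤ b) (hat : a < t) :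
    (t - a) * (K s t - lineInterp a b (K s a) (K s b) t)
      = (s - a) * (K t t - lineInterp a b (K t a) (K t b) t) := by
  have hm : s ∈ Set.Icc a t := ⟨hs, hst⟩
  have htI : t ∈ Set.Icc a b := ⟨hat.le, ht⟩
  have h1 := hK a t s t hat le_rfl ht hm htI (Or.inr le_rfl)
  have h2 := hK a t s a hat le_rfl ht hm ⟨le_rfl, hab.le⟩ (Or.inl le_rfl)
  have h3 := hK a t s b hat le_rfl ht hm ⟨hab.le, le_rfl⟩ (Or.inr ht)
  have h4 := hK a b t a hab le_rfl le_rfl htI ⟨le_rfl, hab.le⟩ (Or.inl le_rfl)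
  rw [hsymm t a, hsymm b a] at h4
  have e1 : t - a ≠ 0 := by linarith
  have e2 : b - a ≠ 0 := by linarith
  rw [h1, h2, h3]
  simp only [lineInterp] at h4 ⊢
  rw [hsymm t a, h4]
  field_simp
  ring

/-- The mirror image: the bridge covariance is affine in `t` on `[s, b]` and vanishes at `t = b`. -/
lemma bridge_eq' (hK : IsAffineOffDiagonal a b K) (hsymm : ∀ s t, K s t = K t s) (hab : a < b)
    {s t : ℝ} (hs : a ≤ s) (hst : s ≤ t) (ht : t ≤ b) (hsb : s < b) :
    (b - s) * (K s t - lineInterp a b (K s a) (K s b) t)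
      = (b - t) * (K s s - lineInterp a b (K s a) (K s b) s) := by
  have hm : t ∈ Set.Icc s b := ⟨hst, ht⟩
  have hsI : s ∈ Set.Icc a b := ⟨hs, hsb.le⟩
  have h1 := hK s b t s hsb hs le_rfl hm hsI (Or.inl le_rfl)
  rw [hsymm t s, hsymm b s] at h1
  have e1 : b - s ≠ 0 := by linarith
  have e2 : b - a ≠ 0 := by linarith
  rw [h1]
  simp only [lineInterp]
  field_simp
  ring

/-- The two proportionalities together make `R t t / ((t - a) * (b - t))` constant, which determines
`R` up to a positive factor. The second difference then measures the jump of slope across the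
diagonal, the same everywhere. -/
lemma exists_bump_diag (hK : IsAffineOffDiagonal a b K) (hsymm : ∀ s t, K s t = K t s)
    (hab : a < b) {x : ℝ} (hx : x ∈ Set.Ioo a b)
    (hpos : 0 < K x x - lineInterp a b (K a x) (K b x) x) :
    ∃ γ : ℝ, 0 < γ ∧ ∀ l r, l < r → a ≤ l → r ≤ b →
      bump (K · ((l + r) / 2)) l r = γ * (r - l) := by
  obtain ⟨hax, hxb⟩ := hx
  set R : ℝ → ℝ → ℝ := fun s t => K s t - lineInterp a b (K s a) (K s b) t with hR
  have hRx : 0 < R x x := by simpa only [hR, hsymm x a, hsymm x b] using hpos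
  have hc : 0 < (x - a) * (b - x) := mul_pos (by linarith) (by linarith)
  have hdiag : ∀ t, a < t → t < b → R t t * ((x - a) * (b - x)) = R x x * ((t - a) * (b - t)) := by
    have key : ∀ s t, a < s → s ≤ t → t < b →
        R t t * ((s - a) * (b - s)) = R s s * ((t - a) * (b - t)) := by
      intro s t hs hst ht
      have h1 := hK.bridge_eq hsymm hab hs.le hst ht.le (by linarith)
      have h2 := hK.bridge_eq' hsymm hab hs.le hst ht.le (by linarith)
      linear_combination (t - a) * h2 - (b - s) * h1
    intro t hat htb
    rcases le_total x t with h | h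
    · exact key x t hax h htb
    · have := key t x hat h hxb
      linarith
  have hoff : ∀ s t, a ≤ s → s ≤ t → t < b → a < t →
      R s t = R x x / ((x - a) * (b - x)) * ((s - a) * (b - t)) := by
    intro s t hs hst htb hat
    have h1 : (t - a) * R s t = (s - a) * R t t := hK.bridge_eq hsymm hab hs hst htb.le hat
    have h2 := hdiag t hat htb
    have e1 : t - a ≠ 0 := by linarith
    rw [div_mul_eq_mul_div, eq_div_iff hc.ne']
    apply mul_left_cancel₀ e1
    linear_combination ((x - a) * (b - x)) * h1 + (s - a) * h2
  -- `hoff` admits `s = a` but not `t = b`; this version is needed when `r = b`.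
  have hoff' : ∀ s t, a < s → s ≤ t → t ≤ b → s < b →
      R s t = R x x / ((x - a) * (b - x)) * ((s - a) * (b - t)) := by
    intro s t hs hst htb hsb
    have h1 : (b - s) * R s t = (b - t) * R s s := hK.bridge_eq' hsymm hab hs.le hst htb hsb
    have h2 := hdiag s hs hsb
    have e1 : b - s ≠ 0 := by linarith
    rw [div_mul_eq_mul_div, eq_div_iff hc.ne']
    apply mul_left_cancel₀ e1
    linear_combination ((x - a) * (b - x)) * h1 + (b - t) * h2
  refine ⟨R x x / ((x - a) * (b - x)) * (b - a) / 4, by have := sub_pos.2 hab; positivity, ?_⟩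
  intro l r hlr hl hr
  set y := (l + r) / 2 with hy
  have hly : l < y := by rw [hy]; linarith
  have hyr : y < r := by rw [hy]; linarith
  have A1 := hoff l y hl hly.le (by linarith) (by linarith)
  have A2 := hoff y y (by linarith) le_rfl (by linarith) (by linarith)
  have A3 := hoff' y r (by linarith) hyr.le hr (by linarith)
  have B1 := hK.bump_eq_zero hlr hl hr ⟨le_rfl, hab.le⟩ (Or.inl hl)
  have B2 := hK.bump_eq_zero hlr hl hr ⟨hab.le, le_rfl⟩ (Or.inr hr)
  have e2 : b - a ≠ 0 := by linarith
  have C : K y r - lineInterp a b (K y a) (K y b) r = K r y - lineInterp a b (K r a) (K r b) y := by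
    have yI : y ∈ Set.Icc a b := ⟨by linarith, by linarith⟩
    have rI : r ∈ Set.Icc a b := ⟨by linarith, by linarith⟩
    have h1 := hK a b y a hab le_rfl le_rfl yI ⟨le_rfl, hab.le⟩ (Or.inl le_rfl)
    have h2 := hK a b y b hab le_rfl le_rfl yI ⟨hab.le, le_rfl⟩ (Or.inr le_rfl)
    have h3 := hK a b r a hab le_rfl le_rfl rI ⟨le_rfl, hab.le⟩ (Or.inl le_rfl)
    have h4 := hK a b r b hab le_rfl le_rfl rI ⟨hab.le, le_rfl⟩ (Or.inr le_rfl)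
    rw [h1, h2, h3, h4, hsymm y r, hsymm a b]
    simp only [lineInterp]
    field_simp
    ring
  have A3' : R r y = R x x / ((x - a) * (b - x)) * ((y - a) * (b - r)) := by
    rw [← A3]; exact C.symm
  -- `K` and `R` differ by terms built from `K · a` and `K · b`, whose second differences vanish
  -- because `a` and `b` are not inside `(l, r)`.
  have D : bump (K · y) l r = bump (R · y) l r + lineInterp a b (bump (K · a) l r)
      (bump (K · b) l r) y := by
    simp only [bump, hR, lineInterp]
    field_simp
    ring
  rw [D, B1, B2]
  simp only [bump, ← hy]
  rw [A1, A2, A3']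
  simp only [lineInterp, hy]
  ring

end IsAffineOffDiagonal

/-! ### The law of the error indicator. -/

lemma IsGaussianProcess.of_mem_span {S T Ω : Type*} [MeasurableSpace Ω] {P : Measure Ω}
    {X : T → Ω → ℝ} (hX : IsGaussianProcess X P) {Y : S → Ω → ℝ}
    (h : ∀ s, Y s ∈ Submodule.span ℝ (Set.range X)) : IsGaussianProcess Y P := by
  refine hX.of_isGaussianProcess fun s => ?_
  obtain ⟨c, hc⟩ := Finsupp.mem_span_range_iff_exists_finsupp.1 (h s)
  refine ⟨c.support, ∑ i : c.support, c i • ContinuousLinearMap.proj i, fun ω => ?_⟩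
  rw [← hc, Finsupp.sum, Finset.sum_apply, ← Finset.sum_coe_sort]
  simp

/-- The random variable `Q₂ - Q₁` computed by `AdapTrap` on `[α, β]`. -/
noncomputable def trapDiff {Ω : Type*} (m : ℕ) (f : ℝ → Ω → ℝ) (α β : ℝ) (ω : Ω) : ℝ :=
  trap (fun x => f x ω) α β (2 * m) - trap (fun x => f x ω) α β m

lemma trapDiff_eq {Ω : Type*} {m : ℕ} (hm : 0 < m) (f : ℝ → Ω → ℝ) (α β : ℝ) :
    trapDiff m f α β = fun ω => (β - α) / (2 * m) * ∑ i ∈ Finset.range m,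
      bump (fun x => f x ω) (α + i * (β - α) / m) (α + (i + 1 : ℕ) * (β - α) / m) := by
  funext ω
  exact trap_two_mul_sub_trap _ α β hm

lemma covariance_bump {Ω : Type*} [MeasurableSpace Ω] {P : Measure Ω} [IsProbabilityMeasure P]
    {f : ℝ → Ω → ℝ} {X : Ω → ℝ} {l r : ℝ} (hl : MemLp (f l) 2 P) (hr : MemLp (f r) 2 P)
    (hlr : MemLp (f ((l + r) / 2)) 2 P) (hX : MemLp X 2 P) :
    cov[fun ω => bump (fun x => f x ω) l r, X; P] = bump (fun s => cov[f s, X; P]) l r := by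
  have h : (fun ω => bump (fun x => f x ω) l r)
      = f ((l + r) / 2) - (1 / 2 : ℝ) • (f l + f r) := by
    funext ω
    simp only [bump, Pi.sub_apply, Pi.smul_apply, Pi.add_apply, smul_eq_mul]
    ring
  rw [h, covariance_sub_left hlr ((hl.add hr).const_smul _) hX, covariance_smul_left,
    covariance_add_left hl hr hX, bump]
  ring

lemma memLp_bump {Ω : Type*} [MeasurableSpace Ω] {P : Measure Ω}
    {f : ℝ → Ω → ℝ} {l r : ℝ} (hl : MemLp (f l) 2 P) (hr : MemLp (f r) 2 P)
    (hlr : MemLp (f ((l + r) / 2)) 2 P) :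
    MemLp (fun ω => bump (fun x => f x ω) l r) 2 P := by
  have h : (fun ω => bump (fun x => f x ω) l r)
      = f ((l + r) / 2) - (1 / 2 : ℝ) • (f l + f r) := by
    funext ω
    simp only [bump, Pi.sub_apply, Pi.smul_apply, Pi.add_apply, smul_eq_mul]
    ring
  rw [h]
  exact hlr.sub ((hl.add hr).const_smul _)

lemma cell_lt {α β : ℝ} (hαβ : α < β) {m : ℕ} (hm : 0 < m) (i : ℕ) :
    α + i * (β - α) / m < α + (i + 1 : ℕ) * (β - α) / m := by
  have := subinterval_lt hαβ hm i
  push_cast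
  simpa only [mul_comm] using this

lemma cell_subset {α β : ℝ} (hαβ : α ≤ β) {m i : ℕ} (hi : i < m) :
    α ≤ α + i * (β - α) / m ∧ α + (i + 1 : ℕ) * (β - α) / m ≤ β := by
  have := subinterval_subset hαβ ⟨i, hi⟩
  push_cast
  simpa only [mul_comm] using this

lemma cell_ordered {α β : ℝ} (hαβ : α ≤ β) {m : ℕ} {i j : ℤ} (hij : i ≤ j) :
    α + i * (β - α) / m ≤ α + j * (β - α) / m := by
  have hij' : (i : ℝ) ≤ j := by exact_mod_cast hij
  have := div_le_div_of_nonneg_right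
    (mul_le_mul_of_nonneg_right hij' (sub_nonneg.2 hαβ)) (Nat.cast_nonneg (α := ℝ) m)
  linarith

lemma cell_mem {a b α β : ℝ} (hα : a ≤ α) (hαβ : α < β) (hβ : β ≤ b) {m i : ℕ} (hi : i < m) :
    α + i * (β - α) / m ∈ Set.Icc a b ∧ α + (i + 1 : ℕ) * (β - α) / m ∈ Set.Icc a b ∧
      (α + i * (β - α) / m + (α + (i + 1 : ℕ) * (β - α) / m)) / 2 ∈ Set.Icc a b := by
  have h1 := cell_lt hαβ (by omega : 0 < m) i
  have h2 := cell_subset hαβ.le hi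
  refine ⟨⟨?_, ?_⟩, ⟨?_, ?_⟩, ⟨?_, ?_⟩⟩ <;> linarith [h2.1, h2.2]

lemma trapDiff_mem_span {Ω : Type*} {f : ℝ → Ω → ℝ} {a b : ℝ} {m : ℕ} (hm : 0 < m) {α β : ℝ} (hα : a ≤ α) (hαβ : α < β) (hβ : β ≤ b) :
    trapDiff m f α β ∈ Submodule.span ℝ (Set.range (fun x : Set.Icc a b => f x)) := by
  have hmem : ∀ x ∈ Set.Icc a b,
      f x ∈ Submodule.span ℝ (Set.range (fun x : Set.Icc a b => f x)) :=
    fun x hx => Submodule.subset_span ⟨⟨x, hx⟩, rfl⟩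
  have key : trapDiff m f α β = ((β - α) / (2 * m)) • ∑ i ∈ Finset.range m,
      (f ((α + i * (β - α) / m + (α + (i + 1 : ℕ) * (β - α) / m)) / 2)
        - (1 / 2 : ℝ) • (f (α + i * (β - α) / m) + f (α + (i + 1 : ℕ) * (β - α) / m))) := by
    rw [trapDiff_eq hm]
    funext ω
    simp only [Pi.smul_apply, Finset.sum_apply, Pi.sub_apply, Pi.add_apply, smul_eq_mul, bump]
    congr 1
    exact Finset.sum_congr rfl fun i _ => by ring
  rw [key]
  refine Submodule.smul_mem _ _ (Submodule.sum_mem _ fun i hi => ?_)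
  have hc := cell_mem hα hαβ hβ (Finset.mem_range.1 hi)
  exact Submodule.sub_mem _ (hmem _ hc.2.2)
    (Submodule.smul_mem _ _ (Submodule.add_mem _ (hmem _ hc.1) (hmem _ hc.2.1)))

/-- The points of `[a, b]` in the lattice through `α` of mesh `(β - α) / m`. -/
def gridPoints (a b : ℝ) (m : ℕ) (α β : ℝ) : Set ℝ :=
  {s | s ∈ Set.Icc a b ∧ ∃ z : ℤ, s = α + z * (β - α) / m}

/-- The σ-algebra generated by the values of the process `f` at the points `gridPoints`. -/
abbrev gridSigma {Ω : Type*} (f : ℝ → Ω → ℝ) (a b : ℝ) (m : ℕ) (α β : ℝ) : MeasurableSpace Ω :=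
  MeasurableSpace.comap (fun ω (s : gridPoints a b m α β) => f s ω) MeasurableSpace.pi

/-- The data of a centred square integrable process with covariance affine off the diagonal. -/
structure IsBridgeLike {Ω : Type*} [MeasurableSpace Ω] (P : Measure Ω) (a b : ℝ)
    (f : ℝ → Ω → ℝ) (γ : ℝ) : Prop where
  measurable : ∀ x ∈ Set.Icc a b, Measurable (f x)
  gaussian : IsGaussianProcess (fun x : Set.Icc a b => f x) P
  centred : ∀ x ∈ Set.Icc a b, ∫ ω, f x ω ∂P = 0
  affine : IsAffineOffDiagonal a b (fun s t => cov[f s, f t; P])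
  bump_diag : ∀ l r, l < r → a ≤ l → r ≤ b →
      bump (fun s => cov[f s, f ((l + r) / 2); P]) l r = γ * (r - l)

lemma IsGaussianProcess.memLp_two {Ω : Type*} [MeasurableSpace Ω] {P : Measure Ω} {a b : ℝ}
    {f : ℝ → Ω → ℝ} (h : IsGaussianProcess (fun x : Set.Icc a b => f x) P) {x : ℝ}
    (hx : x ∈ Set.Icc a b) : MemLp (f x) 2 P :=
  (h.hasGaussianLaw_eval ⟨x, hx⟩).memLp_two

namespace IsBridgeLike

variable {Ω : Type*} [MeasurableSpace Ω] {P : Measure Ω} {a b γ : ℝ} {f : ℝ → Ω → ℝ}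

lemma memLp (h : IsBridgeLike P a b f γ) {x : ℝ} (hx : x ∈ Set.Icc a b) : MemLp (f x) 2 P :=
  IsGaussianProcess.memLp_two h.gaussian hx

lemma isGaussianProcess_sumElim (h : IsBridgeLike P a b f γ) {m : ℕ} (hm : 0 < m) {α β : ℝ}
    (hα : a ≤ α) (hαβ : α < β) (hβ : β ≤ b) :
    IsGaussianProcess (Sum.elim (fun _ : Unit => trapDiff m f α β)
      (fun s : gridPoints a b m α β => f s)) P := by
  refine IsGaussianProcess.of_mem_span h.gaussian fun s => ?_
  rcases s with s | s
  · exact trapDiff_mem_span hm hα hαβ hβ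
  · exact Submodule.subset_span ⟨⟨s, s.2.1⟩, rfl⟩

lemma hasGaussianLaw_trapDiff (h : IsBridgeLike P a b f γ) {m : ℕ} (hm : 0 < m) {α β : ℝ}
    (hα : a ≤ α) (hαβ : α < β) (hβ : β ≤ b) : HasGaussianLaw (trapDiff m f α β) P :=
  (h.isGaussianProcess_sumElim hm hα hαβ hβ).hasGaussianLaw_eval (Sum.inl ())

lemma covariance_trapDiff (h : IsBridgeLike P a b f γ) {m : ℕ} (hm : 0 < m) {α β : ℝ}
    (hα : a ≤ α) (hαβ : α < β) (hβ : β ≤ b) {X : Ω → ℝ} (hX : MemLp X 2 P) :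
    cov[trapDiff m f α β, X; P] = (β - α) / (2 * m) * ∑ i ∈ Finset.range m,
      bump (fun s => cov[f s, X; P])
        (α + i * (β - α) / m) (α + (i + 1 : ℕ) * (β - α) / m) := by
  have := h.gaussian.isProbabilityMeasure
  rw [trapDiff_eq hm, covariance_const_mul_left, covariance_fun_sum_left' _ hX]
  · congr 1
    refine Finset.sum_congr rfl fun i hi => ?_
    have hc := cell_mem hα hαβ hβ (Finset.mem_range.1 hi)
    exact covariance_bump (h.memLp hc.1) (h.memLp hc.2.1) (h.memLp hc.2.2) hX
  · intro i hi
    have hc := cell_mem hα hαβ hβ (Finset.mem_range.1 hi)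
    exact memLp_bump (h.memLp hc.1) (h.memLp hc.2.1) (h.memLp hc.2.2)

/-- No lattice point is interior to a cell, so each second difference of the covariance is zero. -/
lemma covariance_trapDiff_grid (h : IsBridgeLike P a b f γ) {m : ℕ} (hm : 0 < m) {α β : ℝ}
    (hα : a ≤ α) (hαβ : α < β) (hβ : β ≤ b) {s : ℝ} (hs : s ∈ gridPoints a b m α β) :
    cov[trapDiff m f α β, f s; P] = 0 := by
  rw [h.covariance_trapDiff hm hα hαβ hβ (h.memLp hs.1), Finset.sum_eq_zero, mul_zero]
  intro i hi
  have hc := cell_mem hα hαβ hβ (Finset.mem_range.1 hi)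
  refine h.affine.bump_eq_zero (cell_lt hαβ hm i) hc.1.1 hc.2.1.2 hs.1 ?_
  obtain ⟨z, hz⟩ := hs.2
  rw [hz]
  rcases le_or_gt z (i : ℤ) with hzi | hzi
  · exact Or.inl (by exact_mod_cast cell_ordered hαβ.le hzi)
  · exact Or.inr (by exact_mod_cast cell_ordered (m := m) hαβ.le (Int.add_one_le_iff.2 hzi))

lemma covariance_trapDiff_mid (h : IsBridgeLike P a b f γ) {m : ℕ} (hm : 0 < m) {α β : ℝ}
    (hα : a ≤ α) (hαβ : α < β) (hβ : β ≤ b) {i : ℕ} (hi : i < m) :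
    cov[trapDiff m f α β,
      f ((α + i * (β - α) / m + (α + (i + 1 : ℕ) * (β - α) / m)) / 2); P]
      = (β - α) / (2 * m) * (γ * ((β - α) / m)) := by
  have hci := cell_mem hα hαβ hβ hi
  have hlt := cell_lt hαβ hm i
  rw [h.covariance_trapDiff hm hα hαβ hβ (h.memLp hci.2.2), Finset.sum_eq_single i]
  · rw [h.bump_diag _ _ hlt hci.1.1 hci.2.1.2]
    congr 2
    push_cast
    ring
  · intro j hj hji
    have hcj := cell_mem hα hαβ hβ (Finset.mem_range.1 hj)
    refine h.affine.bump_eq_zero (cell_lt hαβ hm j) hcj.1.1 hcj.2.1.2 hci.2.2 ?_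
    rcases lt_or_gt_of_ne hji with hji | hji
    · right
      have : α + (j + 1 : ℕ) * (β - α) / m ≤ α + i * (β - α) / m := by
        exact_mod_cast cell_ordered (α := α) (m := m) (i := (j + 1 : ℕ)) (j := (i : ℕ)) hαβ.le
          (by exact_mod_cast hji)
      linarith
    · left
      have : α + (i + 1 : ℕ) * (β - α) / m ≤ α + j * (β - α) / m := by
        exact_mod_cast cell_ordered (α := α) (m := m) (i := (i + 1 : ℕ)) (j := (j : ℕ)) hαβ.le
          (by exact_mod_cast hji)
      linarith
  · intro h0
    exact absurd (Finset.mem_range.2 hi) h0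

/-- Expanding one factor, only the `m` cell midpoints correlate with the indicator, each equally. -/
lemma variance_trapDiff (h : IsBridgeLike P a b f γ) {m : ℕ} (hm : 0 < m) {α β : ℝ}
    (hα : a ≤ α) (hαβ : α < β) (hβ : β ≤ b) :
    Var[trapDiff m f α β; P] = γ / (4 * m ^ 2) * (β - α) ^ 3 := by
  have hD := h.hasGaussianLaw_trapDiff hm hα hαβ hβ
  rw [← covariance_self hD.aemeasurable, h.covariance_trapDiff hm hα hαβ hβ hD.memLp_two,
    Finset.sum_congr rfl (g := fun _ => (β - α) / (2 * m) * (γ * ((β - α) / m)))]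
  · have : (m : ℝ) ≠ 0 := by positivity
    rw [Finset.sum_const, Finset.card_range, nsmul_eq_mul]
    field_simp
    ring
  · intro i hi
    have hi' := Finset.mem_range.1 hi
    have hc := cell_mem hα hαβ hβ hi'
    have h1 := h.covariance_trapDiff_mid hm hα hαβ hβ hi'
    have h2 := h.covariance_trapDiff_grid hm hα hαβ hβ ⟨hc.1, ⟨i, by simp⟩⟩
    have h3 := h.covariance_trapDiff_grid hm hα hαβ hβ ⟨hc.2.1, ⟨(i + 1 : ℕ), by simp⟩⟩
    rw [covariance_comm] at h1 h2 h3
    rw [bump, h1, h2, h3]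
    ring

lemma integral_trapDiff (h : IsBridgeLike P a b f γ) {m : ℕ} (hm : 0 < m) {α β : ℝ}
    (hα : a ≤ α) (hαβ : α < β) (hβ : β ≤ b) : ∫ ω, trapDiff m f α β ω ∂P = 0 := by
  have := h.gaussian.isProbabilityMeasure
  have hint : ∀ x ∈ Set.Icc a b, Integrable (f x) P := fun x hx =>
    (h.memLp hx).integrable one_le_two
  rw [trapDiff_eq hm]
  simp only [bump]
  rw [integral_const_mul, integral_finsetSum, Finset.sum_eq_zero, mul_zero]
  · intro i hi
    have hc := cell_mem hα hαβ hβ (Finset.mem_range.1 hi)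
    have hadd : Integrable (fun ω => f (α + i * (β - α) / m) ω
        + f (α + (i + 1 : ℕ) * (β - α) / m) ω) P := (hint _ hc.1).add (hint _ hc.2.1)
    rw [integral_sub (hint _ hc.2.2) (hadd.div_const 2), integral_div, integral_add (hint _ hc.1) (hint _ hc.2.1), h.centred _ hc.1,
      h.centred _ hc.2.1, h.centred _ hc.2.2]
    simp
  · intro i hi
    have hc := cell_mem hα hαβ hβ (Finset.mem_range.1 hi)
    exact (hint _ hc.2.2).sub (((hint _ hc.1).add (hint _ hc.2.1)).div_const 2)

/-- Joint Gaussianity upgrades zero covariance to independence from all lattice values at once. -/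
lemma indepFun_trapDiff (h : IsBridgeLike P a b f γ) {m : ℕ} (hm : 0 < m) {α β : ℝ}
    (hα : a ≤ α) (hαβ : α < β) (hβ : β ≤ b) :
    IndepFun (fun ω (_ : Unit) => trapDiff m f α β ω)
      (fun ω (s : gridPoints a b m α β) => f s ω) P :=
  (h.isGaussianProcess_sumElim hm hα hαβ hβ).indepFun_of_covariance_eq_zero
    (fun _ => (h.hasGaussianLaw_trapDiff hm hα hαβ hβ).aemeasurable)
    (fun s => (h.measurable s s.2.1).aemeasurable)
    (fun _ s => h.covariance_trapDiff_grid hm hα hαβ hβ s.2)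

end IsBridgeLike

/-- The law has no atom at `0`, so outer regularity gives a small ball of small mass. -/
lemma exists_gaussianReal_ball_le {v : NNReal} (hv : v ≠ 0) :
    ∃ C : ℝ, 0 < C ∧ gaussianReal 0 v {x | |x| < C} ≤ 1 / 4 := by
  have := nullSingletonClass_gaussianReal (μ := 0) hv
  obtain ⟨U, hU, hUo, hlt⟩ := Set.exists_isOpen_lt_of_lt ({0} : Set ℝ) (μ := gaussianReal 0 v)
    (1 / 4) (by rw [measure_singleton]; norm_num)
  obtain ⟨C, hC, hball⟩ := Metric.isOpen_iff.1 hUo 0 (hU rfl)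
  refine ⟨C, hC, (measure_mono fun x hx => hball ?_).trans hlt.le⟩
  simpa [Real.dist_eq] using hx

/-- The indicator has the law of `(β - α) ^ (3 / 2)` times a fixed centred Gaussian, so one `C`
serves every interval. -/
lemma IsBridgeLike.exists_forall_measure_ge {Ω : Type*} [MeasurableSpace Ω] {P : Measure Ω}
    {a b γ : ℝ} {f : ℝ → Ω → ℝ} (h : IsBridgeLike P a b f γ) (hγ : 0 < γ) {m : ℕ} (hm : 0 < m) :
    ∃ C : ℝ, 0 < C ∧ ∀ α β τ : ℝ, a ≤ α → α < β → β ≤ b → τ ≤ C * (β - α) ^ (3 / 2 : ℝ) →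
      3 / 4 ≤ P {ω | ¬ |trapDiff m f α β ω| < τ} := by
  have hm' : (0 : ℝ) < m := by exact_mod_cast hm
  have hv0 : 0 < γ / (4 * m ^ 2) := by positivity
  set v : NNReal := ⟨γ / (4 * m ^ 2), hv0.le⟩ with hv
  obtain ⟨C, hC, hle⟩ := exists_gaussianReal_ball_le (v := v)
    (fun h0 => hv0.ne' (congrArg NNReal.toReal h0))
  refine ⟨C, hC, fun α β τ hα hαβ hβ hτ => ?_⟩
  have := h.gaussian.isProbabilityMeasure
  have hD := h.hasGaussianLaw_trapDiff hm hα hαβ hβ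
  set c : ℝ := (β - α) ^ (3 / 2 : ℝ) with hc
  have hβα : 0 < β - α := sub_pos.2 hαβ
  have hc0 : 0 < c := Real.rpow_pos_of_pos hβα _
  have hc2 : c ^ 2 = (β - α) ^ 3 := by
    rw [hc, ← Real.rpow_natCast, ← Real.rpow_mul hβα.le, ← Real.rpow_natCast]
    norm_num
  have hlaw : P.map (trapDiff m f α β) = (gaussianReal 0 v).map (c * ·) := by
    rw [hD.map_eq_gaussianReal, h.integral_trapDiff hm hα hαβ hβ,
      h.variance_trapDiff hm hα hαβ hβ, gaussianReal_map_const_mul, mul_zero]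
    congr 1
    ext
    rw [Real.coe_toNNReal _ (by positivity), NNReal.coe_mul]
    change _ = c ^ 2 * (γ / (4 * m ^ 2))
    rw [hc2, mul_comm]
  have habs : ∀ t : ℝ, MeasurableSet {x : ℝ | |x| < t} := fun t =>
    measurableSet_lt measurable_norm measurable_const
  have hsmall : P {ω | |trapDiff m f α β ω| < τ} ≤ 1 / 4 := by
    calc P {ω | |trapDiff m f α β ω| < τ}
        ≤ P (trapDiff m f α β ⁻¹' {x | |x| < C * c}) :=
          measure_mono fun ω hω => lt_of_lt_of_le hω hτ
      _ = gaussianReal 0 v ((c * ·) ⁻¹' {x | |x| < C * c}) := by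
          rw [← Measure.map_apply_of_aemeasurable hD.aemeasurable (habs _), hlaw,
            Measure.map_apply (measurable_const_mul c) (habs _)]
      _ ≤ gaussianReal 0 v {x | |x| < C} := by
          refine measure_mono fun x hx => ?_
          have hx' : |c * x| < C * c := hx
          rw [abs_mul, abs_of_pos hc0, mul_comm] at hx'
          exact lt_of_mul_lt_mul_right hx' hc0.le
      _ ≤ 1 / 4 := hle
  have hnull : NullMeasurableSet {ω | |trapDiff m f α β ω| < τ} P :=
    hD.aemeasurable.nullMeasurable (habs τ)
  have hcompl : P {ω | ¬ |trapDiff m f α β ω| < τ} = 1 - P {ω | |trapDiff m f α β ω| < τ} :=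
    prob_compl_eq_one_sub₀ hnull
  rw [hcompl]
  calc (3 / 4 : ℝ≥0∞) ≤ 1 - 1 / 4 := by
        rw [ENNReal.le_sub_iff_add_le_right (by norm_num) (by norm_num),
          ← ENNReal.add_div]
        norm_num
    _ ≤ _ := tsub_le_tsub_left hsmall 1

/-! ### From conditional means to covariances. -/

section Covariance

variable {Ω : Type*} [MeasurableSpace Ω] {P : Measure Ω} {a b : ℝ} {f : ℝ → Ω → ℝ}

/-- Multiply the conditional mean by `f (x j)`, which is measurable for the conditioning σ-algebra,
and integrate. -/
lemma HasPiecewiseLinearCondMean.covariance_eq {Ω : Type*} {mΩ : MeasurableSpace Ω}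
    {P : Measure Ω} {a b : ℝ} {f : ℝ → Ω → ℝ} (h : HasPiecewiseLinearCondMean P a b f)
    (hmeas : ∀ x ∈ Set.Icc a b, Measurable (f x))
    (hgauss : IsGaussianProcess (fun x : Set.Icc a b => f x) P)
    (hcentred : ∀ x ∈ Set.Icc a b, ∫ ω, f x ω ∂P = 0)
    {n : ℕ} {x : Fin (n + 1) → ℝ} (hx : StrictMono x) (hxI : ∀ i, x i ∈ Set.Icc a b) (i : Fin n)
    {y : ℝ} (hy : y ∈ Set.Icc (x i.castSucc) (x i.succ)) (j : Fin (n + 1)) :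
    cov[f y, f (x j); P] = lineInterp (x i.castSucc) (x i.succ)
      cov[f (x i.castSucc), f (x j); P] cov[f (x i.succ), f (x j); P] y := by
  have := hgauss.isProbabilityMeasure
  have hL : ∀ z ∈ Set.Icc a b, MemLp (f z) 2 P := fun z hz =>
    IsGaussianProcess.memLp_two hgauss hz
  have hyI : y ∈ Set.Icc a b := ⟨(hxI _).1.trans hy.1, hy.2.trans (hxI _).2⟩
  set x₀ := x i.castSucc with hx₀
  set x₁ := x i.succ with hx₁
  have hpi : Measurable fun ω (j : Fin (n + 1)) => f (x j) ω :=
    measurable_pi_iff.2 fun j => hmeas _ (hxI j)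
  set G := MeasurableSpace.comap (fun ω (j : Fin (n + 1)) => f (x j) ω) MeasurableSpace.pi with hG
  have hle : G ≤ mΩ := hpi.comap_le
  have hxj : StronglyMeasurable[G] (f (x j)) :=
    ((measurable_pi_apply j).comp (comap_measurable fun ω (j : Fin (n + 1)) => f (x j) ω)
      : Measurable[G] (f (x j))).stronglyMeasurable
  have hline : (fun ω => lineInterp x₀ x₁ (f x₀ ω) (f x₁ ω) y)
      = ((x₁ - y) / (x₁ - x₀)) • f x₀ + ((y - x₀) / (x₁ - x₀)) • f x₁ := by
    funext ω
    simp only [lineInterp, Pi.add_apply, Pi.smul_apply, smul_eq_mul]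
    ring
  have hlineL : MemLp (fun ω => lineInterp x₀ x₁ (f x₀ ω) (f x₁ ω) y) 2 P := by
    rw [hline]
    exact ((hL _ (hxI _)).const_smul _).add ((hL _ (hxI _)).const_smul _)
  have h1 : ∫ ω, (f y * f (x j)) ω ∂P
      = ∫ ω, ((fun ω => lineInterp x₀ x₁ (f x₀ ω) (f x₁ ω) y) * f (x j)) ω ∂P := by
    rw [← integral_condExp hle]
    refine integral_congr_ae ?_
    filter_upwards [condExp_mul_of_stronglyMeasurable_right hxj
      ((hL y hyI).integrable_mul (hL _ (hxI j))) ((hL y hyI).integrable one_le_two),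
      h n x hx hxI i y hy] with ω h2 h3
    rw [h2, Pi.mul_apply, Pi.mul_apply, h3]
  have h2 : cov[f y, f (x j); P]
      = cov[fun ω => lineInterp x₀ x₁ (f x₀ ω) (f x₁ ω) y, f (x j); P] := by
    rw [covariance_eq_sub (hL y hyI) (hL _ (hxI j)), covariance_eq_sub hlineL (hL _ (hxI j)),
      h1, hcentred _ (hxI j), mul_zero, mul_zero]
  rw [h2, hline, covariance_add_left ((hL _ (hxI _)).const_smul _) ((hL _ (hxI _)).const_smul _)
    (hL _ (hxI j)), covariance_smul_left, covariance_smul_left]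
  simp only [lineInterp]
  ring

/-- With `w` outside `(l, r)`, the points `l` and `r` stay adjacent among the data `l, r, w`. If `w`
is an endpoint, the data are just `l, r`. -/
lemma HasPiecewiseLinearCondMean.isAffineOffDiagonal (h : HasPiecewiseLinearCondMean P a b f)
    (hmeas : ∀ x ∈ Set.Icc a b, Measurable (f x))
    (hgauss : IsGaussianProcess (fun x : Set.Icc a b => f x) P)
    (hcentred : ∀ x ∈ Set.Icc a b, ∫ ω, f x ω ∂P = 0) :
    IsAffineOffDiagonal a b (fun s t => cov[f s, f t; P]) := by
  intro l r y w hlr hal hrb hy hw hwlr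
  have hlI : l ∈ Set.Icc a b := ⟨hal, by linarith⟩
  have hrI : r ∈ Set.Icc a b := ⟨by linarith, hrb⟩
  have two : StrictMono ![l, r] := by
    rw [Fin.strictMono_iff_lt_succ]
    intro i
    fin_cases i
    exact hlr
  have twoI : ∀ i, (![l, r] : Fin 2 → ℝ) i ∈ Set.Icc a b := by
    intro i
    fin_cases i
    exacts [hlI, hrI]
  rcases hwlr with hwl | hrw
  · rcases hwl.eq_or_lt with rfl | hwl
    · exact h.covariance_eq hmeas hgauss hcentred two twoI 0 hy 0
    · have three : StrictMono ![w, l, r] := by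
        rw [Fin.strictMono_iff_lt_succ]
        intro i
        fin_cases i
        exacts [hwl, hlr]
      refine h.covariance_eq hmeas hgauss hcentred three (fun i => ?_) 1 hy 0
      fin_cases i
      exacts [hw, hlI, hrI]
  · rcases hrw.eq_or_lt with rfl | hrw
    · exact h.covariance_eq hmeas hgauss hcentred two twoI 0 hy 1
    · have three : StrictMono ![l, r, w] := by
        rw [Fin.strictMono_iff_lt_succ]
        intro i
        fin_cases i
        exacts [hlr, hrw]
      refine h.covariance_eq hmeas hgauss hcentred three (fun i => ?_) 0 hy 2
      fin_cases i
      exacts [hlI, hrI, hw]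

lemma ae_eq_zero_of_covariance_self_eq_zero [IsProbabilityMeasure P] {X : Ω → ℝ}
    (hX : MemLp X 2 P) (h0 : ∫ ω, X ω ∂P = 0) (h : cov[X, X; P] = 0) : X =ᵐ[P] 0 := by
  rw [covariance_eq_sub hX hX, h0, mul_zero, sub_zero,
    integral_eq_zero_iff_of_nonneg (f := X * X) (fun ω => mul_self_nonneg (X ω)) (hX.integrable_mul hX)] at h
  filter_upwards [h] with ω hω
  exact mul_self_eq_zero.1 hω

lemma covariance_bridge_self [IsProbabilityMeasure P]
    (hL : ∀ z ∈ Set.Icc a b, MemLp (f z) 2 P)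
    (haff : IsAffineOffDiagonal a b (fun s t => cov[f s, f t; P])) (hab : a < b) {x : ℝ}
    (hx : x ∈ Set.Icc a b) :
    cov[fun ω => f x ω - lineInterp a b (f a ω) (f b ω) x,
        fun ω => f x ω - lineInterp a b (f a ω) (f b ω) x; P]
      = cov[f x, f x; P] - lineInterp a b cov[f a, f x; P] cov[f b, f x; P] x := by
  have haI : a ∈ Set.Icc a b := ⟨le_rfl, hab.le⟩
  have hbI : b ∈ Set.Icc a b := ⟨hab.le, le_rfl⟩
  have e : b - a ≠ 0 := by linarith
  set g : Ω → ℝ := fun ω => f x ω - lineInterp a b (f a ω) (f b ω) x with hg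
  have hgeq : g = f x - (((b - x) / (b - a)) • f a + ((x - a) / (b - a)) • f b) := by
    funext ω
    simp only [hg, lineInterp, Pi.sub_apply, Pi.add_apply, Pi.smul_apply, smul_eq_mul]
    ring
  have hlin : MemLp (((b - x) / (b - a)) • f a + ((x - a) / (b - a)) • f b) 2 P :=
    ((hL a haI).const_smul _).add ((hL b hbI).const_smul _)
  have hgL : MemLp g 2 P := by
    rw [hgeq]
    exact (hL x hx).sub hlin
  have key : ∀ Y : Ω → ℝ, MemLp Y 2 P → cov[g, Y; P]
      = cov[f x, Y; P] - lineInterp a b cov[f a, Y; P] cov[f b, Y; P] x := by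
    intro Y hY
    rw [hgeq, covariance_sub_left (hL x hx) hlin hY, covariance_add_left
      ((hL a haI).const_smul _) ((hL b hbI).const_smul _) hY, covariance_smul_left,
      covariance_smul_left, lineInterp]
    ring
  have ha0 : cov[g, f a; P] = 0 := by
    rw [key _ (hL a haI), sub_eq_zero]
    exact haff a b x a hab le_rfl le_rfl hx haI (Or.inl le_rfl)
  have hb0 : cov[g, f b; P] = 0 := by
    rw [key _ (hL b hbI), sub_eq_zero]
    exact haff a b x b hab le_rfl le_rfl hx hbI (Or.inr le_rfl)
  -- The residual is uncorrelated with `f a` and `f b`, so its chord part drops out.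
  have hx' : cov[g, g; P] = cov[g, f x; P] := by
    nth_rewrite 2 [hgeq]
    rw [covariance_sub_right hgL (hL x hx) hlin, covariance_add_right hgL
      ((hL a haI).const_smul _) ((hL b hbI).const_smul _), covariance_smul_right,
      covariance_smul_right, ha0, hb0]
    ring
  rw [hx', key _ (hL x hx)]

lemma HasPiecewiseLinearCondMean.exists_isBridgeLike (h : HasPiecewiseLinearCondMean P a b f)
    (hab : a < b) (hmeas : ∀ x ∈ Set.Icc a b, Measurable (f x))
    (hgauss : IsGaussianProcess (fun x : Set.Icc a b => f x) P)
    (hcentred : ∀ x ∈ Set.Icc a b, ∫ ω, f x ω ∂P = 0)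
    (hnontriv : ¬ ∀ x ∈ Set.Icc a b, ∀ᵐ ω ∂P, f x ω = lineInterp a b (f a ω) (f b ω) x) :
    ∃ γ : ℝ, 0 < γ ∧ IsBridgeLike P a b f γ := by
  have := hgauss.isProbabilityMeasure
  have hL : ∀ z ∈ Set.Icc a b, MemLp (f z) 2 P := fun z hz =>
    IsGaussianProcess.memLp_two hgauss hz
  have haff := h.isAffineOffDiagonal hmeas hgauss hcentred
  have haI : a ∈ Set.Icc a b := ⟨le_rfl, hab.le⟩
  have hbI : b ∈ Set.Icc a b := ⟨hab.le, le_rfl⟩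
  have e : b - a ≠ 0 := by linarith
  push Not at hnontriv
  obtain ⟨x, hx, hne⟩ := hnontriv
  have hxa : x ≠ a := by
    rintro rfl
    refine hne (Filter.Eventually.of_forall fun ω => ?_)
    simp only [lineInterp, sub_self, zero_mul, add_zero, not_not]
    field_simp
  have hxb : x ≠ b := by
    rintro rfl
    refine hne (Filter.Eventually.of_forall fun ω => ?_)
    simp only [lineInterp, sub_self, zero_mul, zero_add, not_not]
    field_simp
  have hself := covariance_bridge_self hL haff hab hx
  have hline : MemLp (fun ω => lineInterp a b (f a ω) (f b ω) x) 2 P := by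
    simp only [lineInterp, div_eq_mul_inv]
    exact (((hL a haI).const_mul (b - x)).add ((hL b hbI).const_mul (x - a))).mul_const (b - a)⁻¹
  have hgL : MemLp (fun ω => f x ω - lineInterp a b (f a ω) (f b ω) x) 2 P := (hL x hx).sub hline
  have hg0 : ∫ ω, (f x ω - lineInterp a b (f a ω) (f b ω) x) ∂P = 0 := by
    rw [integral_sub ((hL x hx).integrable one_le_two) (hline.integrable one_le_two),
      hcentred x hx]
    simp only [lineInterp]
    rw [integral_div, integral_add (((hL a haI).integrable one_le_two).const_mul _)
      (((hL b hbI).integrable one_le_two).const_mul _), integral_const_mul, integral_const_mul,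
      hcentred a haI, hcentred b hbI]
    simp
  -- This is the variance of the centred chord residual; were it zero, the residual would vanish
  -- almost surely.
  have hpos : 0 < cov[f x, f x; P] - lineInterp a b cov[f a, f x; P] cov[f b, f x; P] x := by
    rw [← hself]
    refine lt_of_le_of_ne ?_ fun h0 => hne ?_
    · rw [covariance_self hgL.aemeasurable]
      exact variance_nonneg _ _
    · filter_upwards [ae_eq_zero_of_covariance_self_eq_zero hgL hg0 h0.symm] with ω hω
      exact not_not.2 (sub_eq_zero.1 hω)
  obtain ⟨γ, hγ, hb⟩ := haff.exists_bump_diag (fun s t => covariance_comm _ _) hab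
    ⟨lt_of_le_of_ne hx.1 hxa.symm, lt_of_le_of_ne hx.2 hxb⟩ hpos
  exact ⟨γ, hγ, hmeas, hgauss, hcentred, haff, hb⟩

end Covariance

/-! ### Growth of the expected number of calls. -/

section Branching

variable {Ω : Type*} {a b : ℝ} {f : ℝ → Ω → ℝ}

lemma subinterval_length (α β : ℝ) (k i : ℕ) :
    (α + (β - α) * (i + 1) / k) - (α + (β - α) * i / k) = (β - α) / k := by
  ring

lemma measurable_gridSigma {m : ℕ} {α β s : ℝ} (hs : s ∈ gridPoints a b m α β) :
    Measurable[gridSigma f a b m α β] (f s) :=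
  (measurable_pi_apply (⟨s, hs⟩ : gridPoints a b m α β)).comp
    (comap_measurable fun ω (s : gridPoints a b m α β) => f s ω)

/-- This is where `k` must be even: the child mesh `(β - α) / (k * m)` has to divide the parent's
half mesh `(β - α) / (2 * m)`. -/
lemma gridPoints_two_mul_subset {m k : ℕ} (hm : 0 < m) (hk : 0 < k) (hk_even : Even k)
    (α β : ℝ) (i : ℕ) : gridPoints a b (2 * m) α β ⊆ gridPoints a b m
      (α + (β - α) * i / k) (α + (β - α) * (i + 1) / k) := by
  rintro s ⟨hs, z, rfl⟩
  refine ⟨hs, ?_⟩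
  obtain ⟨c, rfl⟩ := hk_even
  have hc : (c : ℝ) ≠ 0 := by
    have : c ≠ 0 := by omega
    exact_mod_cast this
  have hm' : (m : ℝ) ≠ 0 := by positivity
  refine ⟨z * c - i * m, ?_⟩
  rw [subinterval_length]
  push_cast
  field_simp
  ring

lemma gridPoints_subset_two_mul (m : ℕ) (α β : ℝ) :
    gridPoints a b m α β ⊆ gridPoints a b (2 * m) α β := by
  rintro s ⟨hs, z, rfl⟩
  refine ⟨hs, 2 * z, ?_⟩
  push_cast
  rw [mul_assoc, mul_div_mul_left _ _ two_ne_zero]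

lemma gridSigma_mono {m n : ℕ} {α β α' β' : ℝ}
    (h : gridPoints a b m α β ⊆ gridPoints a b n α' β') :
    gridSigma f a b m α β ≤ gridSigma f a b n α' β' := by
  refine Measurable.comap_le ?_
  refine (@measurable_pi_iff _ _ _ (gridSigma f a b n α' β') _ _).2 fun s => ?_
  exact measurable_gridSigma (h s.2)

lemma gridSigma_le [MeasurableSpace Ω] (h : ∀ x ∈ Set.Icc a b, Measurable (f x)) (m : ℕ)
    (α β : ℝ) : gridSigma f a b m α β ≤ ‹MeasurableSpace Ω› :=
  (measurable_pi_iff.2 fun s : gridPoints a b m α β => h s s.2.1).comap_le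

lemma measurable_trapDiff [MeasurableSpace Ω] {m : ℕ} (hm : 0 < m) {α β : ℝ} (hα : a ≤ α)
    (hαβ : α < β) (hβ : β ≤ b) (h : ∀ s ∈ gridPoints a b (2 * m) α β, Measurable (f s)) :
    Measurable (trapDiff m f α β) := by
  have hm' : (m : ℝ) ≠ 0 := by positivity
  rw [trapDiff_eq hm]
  refine (Finset.measurable_sum _ fun i hi => ?_).const_mul _
  have hc := cell_mem hα hαβ hβ (Finset.mem_range.1 hi)
  have h1 := h _ ⟨hc.1, 2 * i, by push_cast; field_simp⟩
  have h2 := h _ ⟨hc.2.1, 2 * (i + 1), by push_cast; field_simp⟩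
  have h3 := h _ ⟨hc.2.2, 2 * i + 1, by push_cast; field_simp; ring⟩
  exact h3.sub ((h1.add h2).div_const 2)

/-- Superadditivity of the lower integral suffices, so the call counts need not be shown measurable.
-/
lemma finset_sum_lintegral_le [MeasurableSpace Ω] {ι : Type*} (s : Finset ι) (μ : Measure Ω)
    (g : ι → Ω → ℝ≥0∞) : ∑ i ∈ s, ∫⁻ ω, g i ω ∂μ ≤ ∫⁻ ω, ∑ i ∈ s, g i ω ∂μ := by
  classical
  induction s using Finset.induction_on with
  | empty => simp
  | insert i s hi ih =>
    simp only [Finset.sum_insert hi]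
    exact (add_le_add_right ih _).trans (le_lintegral_add _ _)

/-- The bound on `ρ` matches the factor by which `h ^ (3 / 2)` shrinks in one subdivision. -/
lemma child_tolerance_le {C h τ ρ : ℝ} (hC : 0 < C) (hh : 0 < h) {k : ℕ} (hk : 0 < k)
    (hτ : τ ≤ C * h ^ (3 / 2 : ℝ)) (hρ0 : 0 ≤ ρ) (hρ : ρ ≤ (k : ℝ) ^ (-(3 / 2) : ℝ)) :
    ρ * τ ≤ C * (h / k) ^ (3 / 2 : ℝ) := by
  have hk' : (0 : ℝ) < k := by exact_mod_cast hk
  have h1 : (h / k) ^ (3 / 2 : ℝ) = (k : ℝ) ^ (-(3 / 2) : ℝ) * h ^ (3 / 2 : ℝ) := by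
    rw [Real.div_rpow hh.le hk'.le, Real.rpow_neg hk'.le, div_eq_mul_inv, mul_comm]
  have h2 : 0 < C * h ^ (3 / 2 : ℝ) := mul_pos hC (Real.rpow_pos_of_pos hh _)
  calc ρ * τ ≤ ρ * (C * h ^ (3 / 2 : ℝ)) := mul_le_mul_of_nonneg_left hτ hρ0
    _ ≤ (k : ℝ) ^ (-(3 / 2) : ℝ) * (C * h ^ (3 / 2 : ℝ)) := mul_le_mul_of_nonneg_right hρ h2.le
    _ = C * (h / k) ^ (3 / 2 : ℝ) := by rw [h1]; ring

/-- Conditionally on the values of `f` at the grid of `[α, β]`, the expected number of calls at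
depth `d` below `[α, β]` is at least `(3 k / 4) ^ d`. -/
lemma IsBridgeLike.le_setLIntegral_numCalls [MeasurableSpace Ω] {P : Measure Ω} {γ : ℝ}
    (h : IsBridgeLike P a b f γ) {m k : ℕ} (hm : 0 < m) (hk : 0 < k) (hk_even : Even k) {C ρ : ℝ}
    (hC : 0 < C) (hρ0 : 0 ≤ ρ) (hρ : ρ ≤ (k : ℝ) ^ (-(3 / 2) : ℝ))
    (hsplit : ∀ α β τ : ℝ, a ≤ α → α < β → β ≤ b → τ ≤ C * (β - α) ^ (3 / 2 : ℝ) →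
      3 / 4 ≤ P {ω | ¬ |trapDiff m f α β ω| < τ}) (d : ℕ) :
    ∀ (α β τ : ℝ), a ≤ α → α < β → β ≤ b → τ ≤ C * (β - α) ^ (3 / 2 : ℝ) → ∀ A : Set Ω,
      MeasurableSet[gridSigma f a b m α β] A →
      ((k : ℝ≥0∞) * (3 / 4)) ^ d * P A
        ≤ ∫⁻ ω in A, (numCalls ρ m k (fun x => f x ω) d α β τ : ℝ≥0∞) ∂P := by
  induction d with
  | zero =>
    intro α β τ hα hαβ hβ hτ A hA
    simp [numCalls]
  | succ d ih =>
    intro α β τ hα hαβ hβ hτ A hA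
    set S : Set Ω := {ω | ¬ |trapDiff m f α β ω| < τ} with hS
    have hball : MeasurableSet {x : ℝ | ¬ |x| < τ} :=
      (measurableSet_lt measurable_norm measurable_const).compl
    -- The history and the present split are both determined on the child's lattice, so the
    -- induction hypothesis applies to `A ∩ S`.
    have hgrid : ∀ i : Fin k, MeasurableSet[gridSigma f a b m (α + (β - α) * (i : ℕ) / k)
        (α + (β - α) * ((i : ℕ) + 1) / k)] (A ∩ S) := by
      intro i
      have hsub := gridPoints_two_mul_subset (a := a) (b := b) hm hk hk_even α β i
      refine MeasurableSet.inter
        (gridSigma_mono ((gridPoints_subset_two_mul m α β).trans hsub) A hA) ?_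
      exact @measurable_trapDiff Ω a b f (gridSigma f a b m _ _) m hm α β hα hαβ hβ
        (fun s hs => measurable_gridSigma (hsub hs)) _ hball
    have hSm : MeasurableSet S :=
      measurable_trapDiff hm hα hαβ hβ (fun s hs => h.measurable s hs.1) hball
    have hindep : P (A ∩ S) = P A * P S := by
      obtain ⟨T, hT, rfl⟩ := hA
      have hS' : S = (fun ω (_ : Unit) => trapDiff m f α β ω) ⁻¹'
          {g : Unit → ℝ | ¬ |g ()| < τ} := rfl
      rw [Set.inter_comm, mul_comm, hS']
      exact (h.indepFun_trapDiff hm hα hαβ hβ).measure_inter_preimage_eq_mul _ _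
        (measurable_pi_apply (X := fun _ : Unit => ℝ) () hball) hT
    have hchild : ∀ i : Fin k, ((k : ℝ≥0∞) * (3 / 4)) ^ d * P (A ∩ S)
        ≤ ∫⁻ ω in A ∩ S, (numCalls ρ m k (fun x => f x ω) d (α + (β - α) * (i : ℕ) / k)
          (α + (β - α) * ((i : ℕ) + 1) / k) (ρ * τ) : ℝ≥0∞) ∂P := by
      intro i
      have hs := subinterval_subset hαβ.le i
      refine ih _ _ _ (hα.trans hs.1) (subinterval_lt hαβ hk i) (hs.2.trans hβ) ?_ _ (hgrid i)
      rw [subinterval_length]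
      exact child_tolerance_le hC (sub_pos.2 hαβ) hk hτ hρ0 hρ
    calc ((k : ℝ≥0∞) * (3 / 4)) ^ (d + 1) * P A
        = k * (((k : ℝ≥0∞) * (3 / 4)) ^ d * (P A * (3 / 4))) := by ring
      _ ≤ k * (((k : ℝ≥0∞) * (3 / 4)) ^ d * P (A ∩ S)) := by
          rw [hindep]
          gcongr
          exact hsplit α β τ hα hαβ hβ hτ
      _ = ∑ _i : Fin k, ((k : ℝ≥0∞) * (3 / 4)) ^ d * P (A ∩ S) := by simp
      _ ≤ _ := Finset.sum_le_sum fun i _ => hchild i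
      _ ≤ _ := finset_sum_lintegral_le _ _ _
      _ = ∫⁻ ω in A ∩ S, (numCalls ρ m k (fun x => f x ω) (d + 1) α β τ : ℝ≥0∞) ∂P := by
          refine setLIntegral_congr_fun
            ((gridSigma_le h.measurable m α β A hA).inter hSm) fun ω hω => ?_
          have hω' : ¬ |trap (fun x => f x ω) α β (2 * m) - trap (fun x => f x ω) α β m| < τ := hω.2
          rw [numCalls, if_neg hω', Nat.cast_sum]
      _ ≤ _ := lintegral_mono_set Set.inter_subset_left

end Branching

theorem mainTheorem2 {Ω : Type*} [MeasurableSpace Ω] (P : Measure Ω) (a b : ℝ) (hab : a < b)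
    (f : ℝ → Ω → ℝ)
    (hmeas : ∀ x ∈ Set.Icc a b, Measurable (f x))
    (hgauss : IsGaussianProcess (fun x : Set.Icc a b => f x) P)
    (hcentred : ∀ x ∈ Set.Icc a b, ∫ ω, f x ω ∂P = 0)
    (hmean : HasPiecewiseLinearCondMean P a b f)
    (hnontriv : ¬ ∀ x ∈ Set.Icc a b, ∀ᵐ ω ∂P, f x ω = lineInterp a b (f a ω) (f b ω) x)
    (m k : ℕ) (hm : 0 < m) (hk : 0 < k) (hk_even : Even k) :
    ∃ C : ℝ, 0 < C ∧ ∀ τ : ℝ, τ ≤ C → ∀ ρ : ℝ, 0 ≤ ρ → ρ ≤ (k : ℝ) ^ (-(3 / 2) : ℝ) →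
      ∫⁻ ω, (numEvals ρ m k (fun x => f x ω) a b τ : ℝ≥0∞) ∂P = ⊤ ∧
      ∫⁻ ω, (numDistinctEvals ρ m k (fun x => f x ω) a b τ : ℝ≥0∞) ∂P = ⊤ := by
  have := hgauss.isProbabilityMeasure
  obtain ⟨γ, hγ, h⟩ := hmean.exists_isBridgeLike hab hmeas hgauss hcentred hnontriv
  obtain ⟨C, hC, hsplit⟩ := h.exists_forall_measure_ge hγ hm
  refine ⟨C * (b - a) ^ (3 / 2 : ℝ), mul_pos hC (Real.rpow_pos_of_pos (sub_pos.2 hab) _),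
    fun τ hτ ρ hρ0 hρ => ?_⟩
  -- A positive even `k` is at least `2`, so the mean offspring bound is at least `3 / 2`.
  have hk2 : 2 ≤ k := by
    obtain ⟨c, rfl⟩ := hk_even
    omega
  have hone : (1 : ℝ≥0∞) < k * (3 / 4) := by
    calc (1 : ℝ≥0∞) < 2 * (3 / 4) := by
          rw [← mul_div_assoc, ENNReal.lt_div_iff_mul_lt (by norm_num) (by norm_num)]
          norm_num
      _ ≤ k * (3 / 4) := by
          gcongr
          exact_mod_cast hk2
  have hdist : ∫⁻ ω, (numDistinctEvals ρ m k (fun x => f x ω) a b τ : ℝ≥0∞) ∂P = ⊤ := by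
    -- Every depth `d` gives the lower bound `(3 k / 4) ^ d`; let `d` tend to infinity.
    refine top_le_iff.1 (le_of_tendsto' (ENNReal.tendsto_pow_atTop_nhds_top_iff.2 hone) fun d => ?_)
    have hd := h.le_setLIntegral_numCalls hm hk hk_even hC hρ0 hρ hsplit d a b τ le_rfl hab le_rfl
      hτ Set.univ MeasurableSet.univ
    rw [measure_univ, mul_one, setLIntegral_univ] at hd
    refine hd.trans (lintegral_mono fun ω => ?_)
    rw [← ENat.toENNReal_coe]
    exact ENat.toENNReal_le.2 (numCalls_le_numDistinctEvals hm hk hab d)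
  refine ⟨top_le_iff.1 (hdist.symm.le.trans (lintegral_mono fun ω => ?_)), hdist⟩
  exact ENat.toENNReal_le.2 (numDistinctEvals_le_numEvals ρ m k _ a b τ)
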